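/- Let $X$ be a real Hilbert space, $m\ge 1$ an integer, and let $\mathbf X=X^m$ carry the norm $\|\mathbf x\|=\sqrt{\|x_1\|^2+\cdots+\|x_m\|^2}$. Let $\Delta=\{(x,\dots,x): x\in X\}$, let $\mathbf R(x_1,x_2,\dots,x_m)=(x_m,x_1,\dots,x_{m-1})$, and let $$T=\frac1{2m}\sum_{k=1}^{m-1}(m-2k)\mathbf R^k .$$ Let $f_1,\dots,f_m:X\to\,]-\infty,+\infty]$ be proper, lower semicontinuous and convex, and set $\mathbf f(x_1,\dots,x_m)=\sum_{i=1}^m f_i(x_i)$. Write $\iota_\Delta$ for the indicator function of $\Delta$ ($0$ on $\Delta$ and $+\infty$ elsewhere), $^*$ for the Fenchel conjugate, $\Box$ for infimal convolution, $\operatorname{cl}$ for the lower semicontinuous hull, $\partial$ for the subdifferential, $P_{\Delta^\perp}$ for the orthogonal projection onto $\Delta^\perp$, and $\operatorname{Prox}_h=(\operatorname{Id}+\partial h)^{-1}$. Assume that $\operatorname{dom}(\mathbf f^*+\iota_\Delta^*)\neq\varnothing$ (equivalently, $\operatorname{dom}\mathbf f^*\cap\Delta^\perp\ne\varnothing$)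 and let $\mathbf g=\operatorname{cl}(\mathbf f\,\Box\,\iota_\Delta)$. Consider the problems $$(\mathrm{EP})\quad 0\in\partial \mathbf g(\mathbf x)+(\operatorname{Id}-\mathbf R)\mathbf x,\qquad (\mathrm{ED})\quad 0\in\partial(\mathbf f^*+\iota_\Delta^*)(\mathbf y)+\tfrac12\mathbf y+T\mathbf y,$$ $$(\tilde P)\quad 0\in\partial \mathbf g(\mathbf x)+(\operatorname{Id}-\mathbf R)\mathbf x\ \text{ and }\ \mathbf x\in\Delta^\perp .$$ The solutions of (EP) are called generalized cycles and the solutions of (ED) generalized gap vectors. Let $\gamma\in\,]0,1[$, let $\delta=2-\gamma$, and let $(\lambda_n)_{n\ge0}$ be a sequence in $]0,\delta[$ with $\sum_{n}\lambda_n(\delta-\lambda_n)=+\infty$. Let $\mathbf x_0\in\mathbf X$ and, for $n=0,1,2,\dots$, set $$\mathbf y_n=(1-\gamma)\mathbf x_n+\gamma\mathbf R\mathbf x_n,\qquad \mathbf x_{n+1}=\mathbf x_n+\lambda_n\big(\operatorname{Prox}_{\gamma\mathbf g}\mathbf y_n-\mathbf x_n\big).$$ Then $\operatorname{Prox}_{\gamma\mathbf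 g}$ is well defined (single-valued with full domain), and there is $\tilde{\mathbf x}\in\mathbf X$ such that: 1. $(\mathbf x_n)$ converges weakly to $\tilde{\mathbf x}$, and $\tilde{\mathbf x}$ is a generalized cycle, i.e., a solution of (EP). 2. $(\mathbf R\mathbf x_n-\mathbf x_n)$ converges strongly to $\mathbf R\tilde{\mathbf x}-\tilde{\mathbf x}$, which is the unique generalized gap vector, i.e., the unique solution of (ED). 3. $(P_{\Delta^\perp}\mathbf x_n)$ converges strongly to $P_{\Delta^\perp}\tilde{\mathbf x}$, which is the unique solution of $(\tilde P)$. -/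

import Mathlib

open Filter Topology
open scoped Pointwise

noncomputable section

/-- The product Hilbert space `X ^ m`, with the norm `√(‖x₁‖² + ⋯ + ‖xₘ‖²)`. -/
abbrev ProdSpace (X : Type*) (m : ℕ) : Type _ := PiLp 2 (fun _ : Fin m => X)

section ConvexAnalysis

variable {E : Type*} [NormedAddCommGroup E] [InnerProductSpace ℝ E]

/-- `f ∈ Γ₀(E)`: proper, lower semicontinuous and convex (the epigraph is convex), with values
in `]-∞, +∞]`. -/
structure IsGammaZero (f : E → EReal) : Prop where
  ne_bot : ∀ x, f x ≠ ⊥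
  exists_ne_top : ∃ x, f x ≠ ⊤
  lsc : LowerSemicontinuous f
  convex : Convex ℝ {p : E × ℝ | f p.1 ≤ (p.2 : EReal)}

/-- The effective domain `dom f = {x | f x < +∞}`. -/
def effDomain (f : E → EReal) : Set E := {x | f x < ⊤}

/-- The Fenchel conjugate `f* u = sup_x (⟨x, u⟩ - f x)`. -/
def conjugate (f : E → EReal) (u : E) : EReal := ⨆ x : E, (((inner ℝ x u : ℝ) : EReal) - f x)

/-- The infimal convolution `(f □ g) x = inf_y (f y + g (x - y))`. -/
def infConvolution (f g : E → EReal) (x : E) : EReal := ⨅ y : E, (f y + g (x - y))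

open Classical in
/-- The indicator function of `C`, equal to `0` on `C` and to `+∞` off `C`. -/
def convexIndicator (C : Set E) (x : E) : EReal := if x ∈ C then 0 else ⊤

/-- The lower semicontinuous hull `cl f`: the largest lower semicontinuous minorant of `f`. -/
def lscHull (f : E → EReal) (x : E) : EReal :=
  ⨆ h : {h : E → EReal // LowerSemicontinuous h ∧ ∀ z, h z ≤ f z}, h.1 x

/-- The subdifferential `∂f x = {u | ∀ z, f z ≥ f x + ⟨u, z - x⟩}`. -/
def subdifferential (f : E → EReal) (x : E) : Set E :=
  {u | ∀ z : E, f x + ((inner ℝ u (z - x) : ℝ) : EReal) ≤ f z}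

/-- The proximal mapping `Prox_f = (Id + ∂f)⁻¹`: `prox f y` is a point `p` with
`y ∈ p + ∂f p`, i.e. `y - p ∈ ∂f p` (an arbitrary point if there is none). -/
def prox (f : E → EReal) (y : E) : E := Classical.epsilon fun p : E => y - p ∈ subdifferential f p

end ConvexAnalysis

section Cyclic

variable {X : Type*} [NormedAddCommGroup X] [InnerProductSpace ℝ X] {m : ℕ}

/-- The separable sum `(x₁, …, xₘ) ↦ ∑ fᵢ(xᵢ)`. -/
def separableSum (f : Fin m → X → EReal) (x : ProdSpace X m) : EReal := ∑ i, f i (x i)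

variable (X m) in
/-- The diagonal `Δ = {(d, …, d) | d ∈ X}`. -/
def diagonal : Submodule ℝ (ProdSpace X m) where
  carrier := {x | ∃ d : X, ∀ i, x i = d}
  add_mem' := by
    rintro x y ⟨a, ha⟩ ⟨b, hb⟩
    exact ⟨a + b, fun i => by simp [ha i, hb i]⟩
  zero_mem' := ⟨0, fun i => by simp⟩
  smul_mem' := by
    rintro c x ⟨a, ha⟩
    exact ⟨c • a, fun i => by simp [ha i]⟩

instance [CompleteSpace X] : (diagonal X m)ᗮ.HasOrthogonalProjection :=
  haveI : CompleteSpace (diagonal X m)ᗮ := Submodule.instOrthogonalCompleteSpace _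
  Submodule.HasOrthogonalProjection.ofCompleteSpace _

variable (X m) in
/-- The orthogonal projection `P_{Δᗮ}` onto `Δᗮ`. -/
def projPerp [CompleteSpace X] : ProdSpace X m →L[ℝ] ProdSpace X m :=
  (diagonal X m)ᗮ.starProjection

variable (X m) in
/-- The circular right shift `R (x₁, x₂, …, xₘ) = (xₘ, x₁, …, xₘ₋₁)`. -/
def shift : ProdSpace X m ≃ₗᵢ[ℝ] ProdSpace X m :=
  LinearIsometryEquiv.piLpCongrLeft 2 ℝ X (finRotate m)

/-- The skew operator `T = (1 / 2m) ∑_{k=1}^{m-1} (m - 2k) R ^ k`. -/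
def skewOp (x : ProdSpace X m) : ProdSpace X m :=
  (1 / (2 * (m : ℝ))) • ∑ k ∈ Finset.Ico 1 m, ((m : ℝ) - 2 * (k : ℝ)) • (⇑(shift X m))^[k] x

/-- The function `g = cl (f □ ι_Δ)`, where `f` is the separable sum of the `fᵢ`. -/
def regularized (f : Fin m → X → EReal) : ProdSpace X m → EReal :=
  lscHull (infConvolution (separableSum f) (convexIndicator (diagonal X m : Set (ProdSpace X m))))

/-- The function `f* + ι_Δ*`, where `f` is the separable sum of the `fᵢ`. -/
def dualFunction (f : Fin m → X → EReal) (y : ProdSpace X m) : EReal :=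
  conjugate (separableSum f) y
    + conjugate (convexIndicator (diagonal X m : Set (ProdSpace X m))) y

/-- `x` is a generalized cycle of `g = cl (f □ ι_Δ)`: it solves `0 ∈ ∂g x + (Id - R) x`. -/
def IsGeneralizedCycle (f : Fin m → X → EReal) (x : ProdSpace X m) : Prop :=
  0 ∈ subdifferential (regularized f) x + {x - shift X m x}

/-- `x` solves the enlarged primal problem `0 ∈ ∂g x + (Id - R) x` and `x ∈ Δᗮ`. -/
def SolvesEnlargedPrimal (f : Fin m → X → EReal) (x : ProdSpace X m) : Prop :=
  0 ∈ subdifferential (regularized f) x + {x - shift X m x} ∧ x ∈ (diagonal X m)ᗮ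

/-- `y` is a generalized gap vector: it solves the enlarged dual problem
`0 ∈ ∂(f* + ι_Δ*) y + y / 2 + T y`. -/
def IsGeneralizedGapVector (f : Fin m → X → EReal) (y : ProdSpace X m) : Prop :=
  0 ∈ subdifferential (dualFunction f) y + {(1 / 2 : ℝ) • y + skewOp y}

end Cyclic

end

/-!
Write `g = cl (f □ ι_Δ)`, and let `P` denote the orthogonal projection onto `Δ`.

The function `g` is invariant under translations along `Δ`, so all its subgradients lie in `Δᗮ`.
Hence `Prox_{γ g} v - v ∈ Δᗮ`, and `Prox_{γ g}` commutes with translations along `Δ`. Since `R`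
fixes `Δ` pointwise, one step of the iteration leaves `P x` unchanged and acts on `x - P x` through
the map `N u = Prox_{γ g} ((1 - γ) u + γ R u)`, which preserves `Δᗮ`.

On `Δᗮ` the operator `Id / 2 + T` inverts `Id - R` (`half_smul_add_skewOp_sub_shift`, a summation
by parts), so `Id - R` is bounded below there. As `R` is an isometry, this makes
`(1 - γ) Id + γ R` a strict contraction of `Δᗮ` (`exists_norm_convex_combination_shift_le`), and so
is `N`, because `Prox_{γ g}` is firmly nonexpansive. The fixed point `z` of `N` in `Δᗮ` given by
the contraction principle is the solution of the enlarged primal problem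
(`exists_solvesEnlargedPrimal`). Its gap vector `R z - z ∈ ∂g z` solves the enlarged dual problem
by the Fenchel–Young inequality and the formula for `(Id - R)⁻¹` on `Δᗮ`
(`SolvesEnlargedPrimal.isGeneralizedGapVector`). Both uniqueness statements follow from
monotonicity of subdifferentials.

The iterates therefore converge to `z + P x₀`, even in norm: `N` is averaged with constant
`1 / (2 - γ)`, so each step decreases `‖x_n - (z + P x₀)‖ ^ 2` by at least
`λ_n (2 - γ - λ_n) ‖N u_n - u_n‖ ^ 2` where `u_n = x_n - P x_n` (`norm_sq_relaxed_le`), and the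
contraction property bounds `‖N u_n - u_n‖` from below by a multiple of `‖u_n - z‖`. Divergence of
`∑ λ_n (δ - λ_n)` then forces the distances to `0` (`tendsto_zero_of_le_sub_mul`).

The analytic input is that `g` is proper, lower semicontinuous and convex
(`isGammaZero_regularized`), convexity because its epigraph is the closure of a convex set
(`epigraph_lscHull`), and the existence of proximal points
(`IsGammaZero.exists_smul_sub_mem_subdifferential`).
-/

/-! ### Lower semicontinuous hulls -/

section LscHull

variable {E : Type*} [NormedAddCommGroup E]

theorem LowerSemicontinuous.isClosed_real_epigraph {F : Type*} [TopologicalSpace F] {f : F → EReal}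
    (hf : LowerSemicontinuous f) : IsClosed {p : F × ℝ | f p.1 ≤ (p.2 : EReal)} := by
  have h := hf.isClosed_epigraph
  have hc : Continuous fun p : F × ℝ => (p.1, (p.2 : EReal)) :=
    continuous_fst.prodMk (continuous_coe_real_ereal.comp continuous_snd)
  exact h.preimage hc

theorem lscHull_le (f : E → EReal) (x : E) : lscHull f x ≤ f x :=
  iSup_le fun h => h.2.2 x

theorem le_lscHull {f h : E → EReal} (hl : LowerSemicontinuous h) (hle : ∀ z, h z ≤ f z) (x : E) :
    h x ≤ lscHull f x :=
  le_iSup (fun h : {h : E → EReal // LowerSemicontinuous h ∧ ∀ z, h z ≤ f z} => h.1 x)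
    ⟨h, hl, hle⟩

theorem lowerSemicontinuous_lscHull (f : E → EReal) : LowerSemicontinuous (lscHull f) :=
  lowerSemicontinuous_iSup fun h => h.2.1

/-- The epigraph of the lower semicontinuous hull is the closure of the strict epigraph. -/
theorem epigraph_lscHull (f : E → EReal) :
    {p : E × ℝ | lscHull f p.1 ≤ (p.2 : EReal)}
      = closure {p : E × ℝ | f p.1 < (p.2 : EReal)} := by
  refine Set.Subset.antisymm ?_ (closure_minimal
    (fun p hp => (lscHull_le f p.1).trans (le_of_lt hp))
    (lowerSemicontinuous_lscHull f).isClosed_real_epigraph)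
  rintro ⟨x, r⟩ hx
  by_contra hcl
  obtain ⟨ε, hε, hball⟩ := Metric.isOpen_iff.1 isClosed_closure.isOpen_compl (x, r) hcl
  classical
  -- The lower semicontinuous minorant equal to `r + ε / 2` near `x` and to `⊥` elsewhere.
  let h : E → EReal := fun z => if z ∈ Metric.ball x ε then ((r + ε / 2 : ℝ) : EReal) else ⊥
  have hl : LowerSemicontinuous h := by
    intro z c hc
    by_cases hz : z ∈ Metric.ball x ε
    · filter_upwards [Metric.isOpen_ball.mem_nhds hz] with w hw
      simpa only [h, if_pos hz, if_pos hw] using hc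
    · simp only [h, if_neg hz, not_lt_bot] at hc
  have hle : ∀ z, h z ≤ f z := by
    intro z
    by_cases hz : z ∈ Metric.ball x ε
    · simp only [h, if_pos hz]
      by_contra hlt
      have hmem : (z, r + ε / 2) ∈ {p : E × ℝ | f p.1 < (p.2 : EReal)} := not_le.1 hlt
      refine hball (a := (z, r + ε / 2)) ?_ (subset_closure hmem)
      rw [← ball_prod_same]
      refine ⟨hz, ?_⟩
      rw [Metric.mem_ball, Real.dist_eq, add_sub_cancel_left, abs_of_pos (by positivity)]
      linarith
    · simp only [h, if_neg hz, bot_le]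
  have := (le_lscHull hl hle x).trans hx
  simp only [h, if_pos (Metric.mem_ball_self hε)] at this
  have := EReal.coe_le_coe_iff.1 this
  linarith

end LscHull

/-! ### Subdifferentials and proximal points -/

section ConvexAnalysis

variable {E : Type*} [NormedAddCommGroup E] [InnerProductSpace ℝ E]

theorem exists_coe_eq_of_mem_subdifferential {f : E → EReal} (hbot : ∀ x, f x ≠ ⊥)
    (htop : ∃ x, f x ≠ ⊤) {x u : E} (hu : u ∈ subdifferential f x) : ∃ r : ℝ, f x = r := by
  obtain ⟨z, hz⟩ := htop
  have hx : f x ≠ ⊤ := fun h => by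
    have := hu z
    rw [h, EReal.top_add_coe, top_le_iff] at this
    exact hz this
  exact ⟨_, (EReal.coe_toReal hx (hbot x)).symm⟩

theorem inner_nonneg_of_mem_subdifferential {f : E → EReal} (hbot : ∀ x, f x ≠ ⊥)
    (htop : ∃ x, f x ≠ ⊤) {x x' u u' : E} (hu : u ∈ subdifferential f x)
    (hu' : u' ∈ subdifferential f x') : 0 ≤ inner ℝ (u - u') (x - x') := by
  obtain ⟨r, hr⟩ := exists_coe_eq_of_mem_subdifferential hbot htop hu
  obtain ⟨s, hs⟩ := exists_coe_eq_of_mem_subdifferential hbot htop hu'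
  have h1 := hu x'
  have h2 := hu' x
  rw [hr, hs] at h1 h2
  norm_cast at h1 h2
  simp only [inner_sub_left, inner_sub_right] at *
  linarith

theorem mem_subdifferential_iff_real {f : E → EReal} (hbot : ∀ x, f x ≠ ⊥) {x u : E} {r : ℝ}
    (hr : f x = r) :
    u ∈ subdifferential f x ↔ ∀ z (s : ℝ), f z ≤ s → r + inner ℝ u (z - x) ≤ s := by
  constructor
  · intro hu z s hs
    have := (hu z).trans hs
    rw [hr] at this
    exact_mod_cast this
  · intro h z
    rw [hr]
    rcases eq_or_ne (f z) ⊤ with ht | ht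
    · rw [ht]; exact le_top
    · have hc := EReal.coe_toReal ht (hbot z)
      have := h z _ hc.ge
      rw [← hc]
      exact_mod_cast this

theorem mem_subdifferential_const_mul {f : E → EReal} (hbot : ∀ x, f x ≠ ⊥) {γ : ℝ} (hγ : 0 < γ)
    {x u : E} :
    γ • u ∈ subdifferential (fun z => (γ : EReal) * f z) x ↔ u ∈ subdifferential f x := by
  refine forall_congr' fun z => ?_
  have hx := hbot x
  have hz := hbot z
  rw [real_inner_smul_left]
  beta_reduce
  generalize f x = a at *
  generalize f z = b at *
  generalize inner ℝ u (z - x) = c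
  induction a with
  | bot => exact absurd rfl hx
  | top =>
    rw [EReal.coe_mul_top_of_pos hγ, EReal.top_add_coe, EReal.top_add_coe]
    induction b with
    | bot => exact absurd rfl hz
    | top => rw [EReal.coe_mul_top_of_pos hγ]
    | coe b =>
      rw [← EReal.coe_mul]
      exact iff_of_false (fun h => EReal.coe_ne_top _ (top_le_iff.1 h))
        fun h => EReal.coe_ne_top _ (top_le_iff.1 h)
  | coe a =>
    induction b with
    | bot => exact absurd rfl hz
    | top => rw [EReal.coe_mul_top_of_pos hγ]; simp
    | coe b =>
      norm_cast
      rw [← mul_add]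
      exact mul_le_mul_iff_right₀ hγ

/-- Existence of proximal points. The point is the first coordinate of the minimizer of
`(z, r) ↦ r + c / 2 * ‖z - v‖ ^ 2` over the epigraph; minimizing sequences are Cauchy by the
parallelogram identity. -/
theorem IsGammaZero.exists_smul_sub_mem_subdifferential [CompleteSpace E] {g : E → EReal}
    (hg : IsGammaZero g) {u : E} {b : ℝ} (hub : ∀ z, ((inner ℝ z u - b : ℝ) : EReal) ≤ g z)
    {c : ℝ} (hc : 0 < c) (v : E) : ∃ p, c • (v - p) ∈ subdifferential g p := by
  let A : Set (E × ℝ) := {p | g p.1 ≤ (p.2 : EReal)}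
  let J : E × ℝ → ℝ := fun p => p.2 + c / 2 * ‖p.1 - v‖ ^ 2
  have hAcl : IsClosed A := hg.lsc.isClosed_real_epigraph
  have hAne : A.Nonempty := by
    obtain ⟨z, hz⟩ := hg.exists_ne_top
    exact ⟨(z, (g z).toReal), (EReal.coe_toReal hz (hg.ne_bot z)).ge⟩
  have hJbdd : BddBelow (J '' A) := by
    refine ⟨inner ℝ v u - b - ‖u‖ ^ 2 / (2 * c), ?_⟩
    rintro _ ⟨⟨z, r⟩, hp, rfl⟩
    have h1 : inner ℝ z u - b ≤ r := EReal.coe_le_coe_iff.1 ((hub z).trans hp)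
    have h2 : 0 ≤ ‖c • (z - v) + u‖ ^ 2 / (2 * c) := by positivity
    rw [norm_add_sq_real, norm_smul, real_inner_smul_left, inner_sub_left, Real.norm_eq_abs,
      mul_pow, sq_abs] at h2
    have h3 : (c ^ 2 * ‖z - v‖ ^ 2 + 2 * (c * (inner ℝ z u - inner ℝ v u)) + ‖u‖ ^ 2) / (2 * c)
        = c / 2 * ‖z - v‖ ^ 2 + (inner ℝ z u - inner ℝ v u) + ‖u‖ ^ 2 / (2 * c) := by
      field_simp
    simp only [J]
    linarith
  set I := sInf (J '' A)
  have hIle : ∀ p ∈ A, I ≤ J p := fun p hp => csInf_le hJbdd ⟨p, hp, rfl⟩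
  have hex : ∀ n : ℕ, ∃ p ∈ A, J p < I + 1 / ((n : ℝ) + 1) := fun n => by
    obtain ⟨_, ⟨p, hp, rfl⟩, hlt⟩ := exists_lt_of_csInf_lt (hAne.image J)
      (show sInf (J '' A) < I + 1 / ((n : ℝ) + 1) from lt_add_of_pos_right _ (by positivity))
    exact ⟨p, hp, hlt⟩
  choose p hpA hpJ using hex
  have hJlim : Tendsto (fun n => J (p n)) atTop (𝓝 I) := by
    refine tendsto_of_tendsto_of_tendsto_of_le_of_le tendsto_const_nhds ?_
      (fun n => hIle _ (hpA n)) (fun n => (hpJ n).le)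
    simpa using tendsto_one_div_add_atTop_nhds_zero_nat.const_add I
  have hmid : ∀ n k, c / 8 * ‖(p n).1 - (p k).1‖ ^ 2 ≤ (J (p n) + J (p k)) / 2 - I := by
    intro n k
    have hm := hIle _ (hg.convex (hpA n) (hpA k) (by norm_num : (0 : ℝ) ≤ 1 / 2)
      (by norm_num : (0 : ℝ) ≤ 1 / 2) (by norm_num))
    have hpar := parallelogram_law_with_norm ℝ ((p n).1 - v) ((p k).1 - v)
    have e1 : (p n).1 - v - ((p k).1 - v) = (p n).1 - (p k).1 := by abel
    have e2 : ((1 / 2 : ℝ) • p n + (1 / 2 : ℝ) • p k).1 - v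
        = (1 / 2 : ℝ) • ((p n).1 - v + ((p k).1 - v)) := by
      simp only [Prod.fst_add, Prod.smul_fst]
      module
    rw [e1] at hpar
    simp only [J, e2, norm_smul, Prod.snd_add, Prod.smul_snd, smul_eq_mul] at hm ⊢
    norm_num [mul_pow] at hm
    nlinarith
  have hcau : CauchySeq fun n => (p n).1 := by
    rw [Metric.cauchySeq_iff']
    intro ε hε
    have hpos : 0 < c / 8 * ε ^ 2 := by positivity
    obtain ⟨M, hM⟩ :=
      (hJlim.eventually (gt_mem_nhds (lt_add_of_pos_right I hpos))).exists_forall_of_atTop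
    refine ⟨M, fun n hn => ?_⟩
    have h1 := hmid n M
    have h2 := hM n hn
    have h3 := hM M le_rfl
    have h4 : c / 8 * ‖(p n).1 - (p M).1‖ ^ 2 < c / 8 * ε ^ 2 := by linarith
    rw [dist_eq_norm]
    exact lt_of_pow_lt_pow_left₀ 2 hε.le (lt_of_mul_lt_mul_left h4 (by positivity))
  obtain ⟨z, hz⟩ := cauchySeq_tendsto_of_complete hcau
  set r := I - c / 2 * ‖z - v‖ ^ 2 with hr
  have hrlim : Tendsto (fun n => (p n).2) atTop (𝓝 r) := by
    have h := hJlim.sub ((((hz.sub_const v).norm).pow 2).const_mul (c / 2))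
    refine h.congr fun n => ?_
    simp only [J]
    ring
  have hzA : (z, r) ∈ A := hAcl.mem_of_tendsto (hz.prodMk_nhds hrlim)
    (Eventually.of_forall hpA)
  have hgz : g z = r := by
    have ht : g z ≠ ⊤ := fun h => by
      have h' : g z ≤ (r : EReal) := hzA
      rw [h, top_le_iff] at h'
      exact EReal.coe_ne_top r h'
    refine le_antisymm hzA ?_
    have hc' := EReal.coe_toReal ht (hg.ne_bot z)
    have := hIle (z, (g z).toReal) hc'.ge
    rw [← hc', EReal.coe_le_coe_iff]
    simp only [J] at this
    linarith
  refine ⟨z, (mem_subdifferential_iff_real hg.ne_bot hgz).2 fun w s hs => ?_⟩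
  -- Compare the values of `J` along the segment from `(z, r)` to `(w, s)`.
  have hseg : ∀ t ∈ Set.Ioo (0 : ℝ) 1,
      0 ≤ (s - r - inner ℝ (c • (v - z)) (w - z)) + t * (c / 2 * ‖w - z‖ ^ 2) := by
    intro t ht
    have hm := hIle _ (hg.convex hzA (show (w, s) ∈ A from hs) (sub_nonneg.2 ht.2.le) ht.1.le
      (by ring))
    have e : (1 - t) • z + t • w - v = (z - v) + t • (w - z) := by module
    simp only [J, Prod.fst_add, Prod.smul_fst, Prod.snd_add, Prod.smul_snd, smul_eq_mul] at hm
    rw [e, norm_add_sq_real, real_inner_smul_right, norm_smul, mul_pow, Real.norm_eq_abs, sq_abs]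
      at hm
    have e' : inner ℝ (c • (v - z)) (w - z) = -(c * inner ℝ (z - v) (w - z)) := by
      rw [real_inner_smul_left, ← neg_sub z v, inner_neg_left]
      ring
    rw [e']
    refine nonneg_of_mul_nonneg_right (a := t) ?_ ht.1
    nlinarith
  have hlim : Tendsto (fun t : ℝ => (s - r - inner ℝ (c • (v - z)) (w - z))
      + t * (c / 2 * ‖w - z‖ ^ 2)) (𝓝[>] 0) (𝓝 (s - r - inner ℝ (c • (v - z)) (w - z))) := by
    have : Continuous fun t : ℝ => (s - r - inner ℝ (c • (v - z)) (w - z))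
      + t * (c / 2 * ‖w - z‖ ^ 2) := by fun_prop
    simpa using (this.tendsto 0).mono_left nhdsWithin_le_nhds
  have := ge_of_tendsto hlim (by
    filter_upwards [Ioo_mem_nhdsGT (zero_lt_one' ℝ)] with t ht using hseg t ht)
  linarith

end ConvexAnalysis

/-! ### The circular shift and the skew operator -/

section Shift

open scoped Fin.CommRing

variable {X : Type*} [NormedAddCommGroup X] [InnerProductSpace ℝ X] {m : ℕ}

theorem shift_apply [NeZero m] (x : ProdSpace X m) (i : Fin m) : shift X m x i = x (i - 1) := by
  simp [shift, LinearIsometryEquiv.piLpCongrLeft_apply, Equiv.piCongrLeft']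

theorem shift_iterate_apply [NeZero m] (k : ℕ) (x : ProdSpace X m) (i : Fin m) :
    (shift X m)^[k] x i = x (i - k) := by
  induction k generalizing i with
  | zero => simp
  | succ k ih =>
    rw [Function.iterate_succ_apply', shift_apply, ih, Nat.cast_succ, sub_sub, add_comm (1 : Fin m)]

theorem shift_iterate_self [NeZero m] (x : ProdSpace X m) : (shift X m)^[m] x = x := by
  ext i
  rw [shift_iterate_apply, Fin.natCast_self, sub_zero]

theorem mem_diagonal_iff_shift_eq [NeZero m] {x : ProdSpace X m} :
    x ∈ diagonal X m ↔ shift X m x = x := by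
  constructor
  · rintro ⟨d, hd⟩
    ext i
    rw [shift_apply, hd, hd]
  · intro h
    refine ⟨x 0, fun i => ?_⟩
    have hk : ∀ k : ℕ, (shift X m)^[k] x = x := fun k => Function.iterate_fixed h k
    have := shift_iterate_apply (i : ℕ) x i
    rw [hk, Fin.cast_val_eq_self, sub_self] at this
    exact this

theorem inner_shift_iterate (k : ℕ) (x y : ProdSpace X m) :
    inner ℝ ((shift X m)^[k] x) ((shift X m)^[k] y) = inner ℝ x y := by
  induction k with
  | zero => rfl
  | succ k ih =>
    rw [Function.iterate_succ_apply', Function.iterate_succ_apply',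
      LinearIsometryEquiv.inner_map_map, ih]

theorem shift_iterate_sub (k : ℕ) (x y : ProdSpace X m) :
    (shift X m)^[k] (x - y) = (shift X m)^[k] x - (shift X m)^[k] y := by
  induction k with
  | zero => rfl
  | succ k ih => simp only [Function.iterate_succ_apply', ih, map_sub]

theorem norm_shift_iterate (k : ℕ) (x : ProdSpace X m) : ‖(shift X m)^[k] x‖ = ‖x‖ := by
  induction k with
  | zero => rfl
  | succ k ih => rw [Function.iterate_succ_apply', LinearIsometryEquiv.norm_map, ih]

theorem shift_mem_diagonal_orthogonal [NeZero m] {x : ProdSpace X m}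
    (hx : x ∈ (diagonal X m)ᗮ) : shift X m x ∈ (diagonal X m)ᗮ := by
  intro d hd
  rw [← mem_diagonal_iff_shift_eq.1 hd, LinearIsometryEquiv.inner_map_map]
  exact hx d hd

theorem isClosed_diagonal_submodule [NeZero m] : IsClosed (diagonal X m : Set (ProdSpace X m)) := by
  have : (diagonal X m : Set (ProdSpace X m)) = {x | shift X m x = x} :=
    Set.ext fun x => mem_diagonal_iff_shift_eq
  rw [this]
  exact isClosed_eq (shift X m).continuous continuous_id

theorem eq_zero_of_mem_diagonal_orthogonal_of_shift_eq [NeZero m] {x : ProdSpace X m}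
    (hx : x ∈ (diagonal X m)ᗮ) (h : shift X m x = x) : x = 0 :=
  inner_self_eq_zero.1 (hx x (mem_diagonal_iff_shift_eq.2 h))

/-- `⟨R x - x, x⟩ = -‖R x - x‖² / 2`, since `R` is an isometry. -/
theorem inner_shift_sub_self (x : ProdSpace X m) :
    inner ℝ (shift X m x - x) x = -(1 / 2) * ‖shift X m x - x‖ ^ 2 := by
  rw [norm_sub_sq_real, LinearIsometryEquiv.norm_map, inner_sub_left, real_inner_self_eq_norm_sq]
  ring

theorem sum_shift_iterate_eq_zero [NeZero m] {x : ProdSpace X m} (hx : x ∈ (diagonal X m)ᗮ) :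
    ∑ k ∈ Finset.range m, (shift X m)^[k] x = 0 := by
  refine eq_zero_of_mem_diagonal_orthogonal_of_shift_eq
    (Submodule.sum_mem _ fun k hk => ?_) ?_
  · clear hk
    induction k with
    | zero => exact hx
    | succ k ih =>
      rw [Function.iterate_succ_apply']
      exact shift_mem_diagonal_orthogonal ih
  · rw [map_sum, ← sub_eq_zero, ← Finset.sum_sub_distrib]
    simp only [← Function.iterate_succ_apply']
    rw [Finset.sum_range_sub (fun k => (shift X m)^[k] x), shift_iterate_self]
    simp

theorem skewOp_sub (x y : ProdSpace X m) : skewOp (x - y) = skewOp x - skewOp y := by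
  simp only [skewOp, shift_iterate_sub, smul_sub, Finset.sum_sub_distrib]

theorem inner_skewOp_self [NeZero m] (x : ProdSpace X m) : inner ℝ x (skewOp x) = 0 := by
  -- The reflection `k ↦ m - k` changes the sign of each coefficient `m - 2 * k`
  -- and preserves `⟨x, R ^ k x⟩`.
  let φ : ℕ → ℝ := fun k => ((m : ℝ) - 2 * k) * inner ℝ x ((shift X m)^[k] x)
  have hrefl : ∀ k ∈ Finset.Ico 1 m, φ (m - k) = -φ k := by
    intro k hk
    have hkm : k ≤ m := (Finset.mem_Ico.1 hk).2.le
    have h : inner ℝ x ((shift X m)^[m - k] x) = inner ℝ x ((shift X m)^[k] x) := by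
      rw [← inner_shift_iterate k x, ← Function.iterate_add_apply, Nat.add_sub_cancel' hkm,
        shift_iterate_self, real_inner_comm]
    simp only [φ, h, Nat.cast_sub hkm]
    ring
  have hsum : ∑ k ∈ Finset.Ico 1 m, φ (m - k) = ∑ k ∈ Finset.Ico 1 m, φ k := by
    rw [Finset.sum_Ico_reflect φ 1 (Nat.le_succ m)]
    simp
  rw [Finset.sum_congr rfl hrefl, Finset.sum_neg_distrib] at hsum
  have h0 : ∑ k ∈ Finset.Ico 1 m, φ k = 0 := by linarith
  rw [skewOp, real_inner_smul_right, inner_sum]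
  simp only [real_inner_smul_right]
  exact mul_eq_zero_of_right _ h0

/-- Summation by parts for the coefficients `c - 2 * k`. -/
theorem sum_sub_two_mul_smul_sub {M : Type*} [AddCommGroup M] [Module ℝ M] (c : ℝ) (a : ℕ → M)
    (n : ℕ) : ∑ k ∈ Finset.range n, (c - 2 * (k : ℝ)) • (a k - a (k + 1))
      = c • a 0 - (c - 2 * n) • a n - (2 : ℝ) • ∑ k ∈ Finset.range n, a (k + 1) := by
  induction n with
  | zero => simp
  | succ n ih =>
    rw [Finset.sum_range_succ, ih, Finset.sum_range_succ]
    push_cast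
    module

/-- On the orthogonal complement of the diagonal, `Id / 2 + T` inverts `Id - R`. -/
theorem half_smul_add_skewOp_sub_shift [NeZero m] {x : ProdSpace X m}
    (hx : x ∈ (diagonal X m)ᗮ) :
    (1 / 2 : ℝ) • (x - shift X m x) + skewOp (x - shift X m x) = x := by
  have hm : (m : ℝ) ≠ 0 := NeZero.ne _
  let a : ℕ → ProdSpace X m := fun k => (shift X m)^[k] x
  have h := sum_sub_two_mul_smul_sub (m : ℝ) a m
  have ham : a m = x := shift_iterate_self x
  have hsum : ∑ k ∈ Finset.range m, a (k + 1) = 0 :=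
    sum_shift_iterate_eq_zero (shift_mem_diagonal_orthogonal hx)
  rw [hsum, ham, Finset.range_eq_Ico, Finset.sum_eq_sum_Ico_succ_bot (NeZero.pos m)] at h
  have hT : skewOp (x - shift X m x) = (1 / (2 * (m : ℝ))) •
      ∑ k ∈ Finset.Ico 1 m, ((m : ℝ) - 2 * (k : ℝ)) • (a k - a (k + 1)) := by
    simp only [skewOp, shift_iterate_sub, a, Function.iterate_succ_apply]
  have h' : ∑ k ∈ Finset.Ico 1 m, ((m : ℝ) - 2 * (k : ℝ)) • (a k - a (k + 1))
      = (m : ℝ) • (x + shift X m x) := by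
    have e := eq_sub_of_add_eq' h
    simp only [zero_add] at e
    rw [e]
    simp only [a, Function.iterate_zero, Function.iterate_one, id_eq, Nat.cast_zero]
    module
  rw [hT, h', smul_smul]
  have : 1 / (2 * (m : ℝ)) * m = 1 / 2 := by field_simp
  rw [this]
  module

/-- `Id - R` is bounded below on the orthogonal complement of the diagonal, as it has the bounded
left inverse `Id / 2 + T` there. -/
theorem exists_norm_le_mul_norm_sub_shift [NeZero m] : ∃ C : ℝ, 1 ≤ C ∧
    ∀ x : ProdSpace X m, x ∈ (diagonal X m)ᗮ → ‖x‖ ≤ C * ‖x - shift X m x‖ := by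
  refine ⟨1 + |1 / (2 * (m : ℝ))| * ∑ k ∈ Finset.Ico 1 m, |(m : ℝ) - 2 * (k : ℝ)|,
    le_add_of_nonneg_right (by positivity), fun x hx => ?_⟩
  have hT : ∀ w : ProdSpace X m, ‖skewOp w‖
      ≤ |1 / (2 * (m : ℝ))| * (∑ k ∈ Finset.Ico 1 m, |(m : ℝ) - 2 * (k : ℝ)|) * ‖w‖ := by
    intro w
    rw [skewOp, norm_smul, Real.norm_eq_abs, mul_assoc, Finset.sum_mul]
    refine mul_le_mul_of_nonneg_left (norm_sum_le_of_le _ fun k _ => ?_) (abs_nonneg _)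
    rw [norm_smul, Real.norm_eq_abs, norm_shift_iterate]
  conv_lhs => rw [← half_smul_add_skewOp_sub_shift hx]
  refine (norm_add_le _ _).trans ?_
  rw [add_mul]
  refine add_le_add ?_ (hT _)
  rw [norm_smul]
  norm_num
  linarith [norm_nonneg (x - shift X m x)]

end Shift

/-! ### The regularized function and the dual function -/

section Regularization

theorem EReal.sum_ne_bot {ι : Type*} {s : Finset ι} {a : ι → EReal} (h : ∀ i ∈ s, a i ≠ ⊥) :
    ∑ i ∈ s, a i ≠ ⊥ :=
  Finset.sum_induction a (· ≠ ⊥) (fun _ _ hx hy => EReal.add_ne_bot_iff.2 ⟨hx, hy⟩)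
    EReal.zero_ne_bot h

theorem EReal.coe_finset_sum {ι : Type*} (s : Finset ι) (a : ι → ℝ) :
    ((∑ i ∈ s, a i : ℝ) : EReal) = ∑ i ∈ s, (a i : EReal) := by
  classical
  induction s using Finset.induction_on with
  | empty => simp
  | insert i s hi ih => rw [Finset.sum_insert hi, Finset.sum_insert hi, EReal.coe_add, ih]

variable {X : Type*} [NormedAddCommGroup X] [InnerProductSpace ℝ X] {m : ℕ}
  {f : Fin m → X → EReal}

theorem separableSum_ne_bot (hf : ∀ i, IsGammaZero (f i)) (x : ProdSpace X m) :
    separableSum f x ≠ ⊥ :=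
  EReal.sum_ne_bot fun i _ => (hf i).ne_bot (x i)

theorem separableSum_lt_coe_iff (hf : ∀ i, IsGammaZero (f i)) {x : ProdSpace X m} {r : ℝ} :
    separableSum f x < r ↔ ∃ ρ : Fin m → ℝ, (∀ i, f i (x i) ≤ ρ i) ∧ ∑ i, ρ i < r := by
  constructor
  · intro h
    have hne : ∀ i, f i (x i) ≠ ⊤ := fun i hi => by
      rw [separableSum, ← Finset.add_sum_erase _ _ (Finset.mem_univ i), hi,
        EReal.top_add_of_ne_bot (EReal.sum_ne_bot fun j _ => (hf j).ne_bot _)] at h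
      exact not_top_lt h
    have hc : ∀ i, ((f i (x i)).toReal : EReal) = f i (x i) :=
      fun i => EReal.coe_toReal (hne i) ((hf i).ne_bot _)
    refine ⟨fun i => (f i (x i)).toReal, fun i => (hc i).ge, ?_⟩
    rw [← EReal.coe_lt_coe_iff, EReal.coe_finset_sum]
    simpa only [hc, separableSum] using h
  · rintro ⟨ρ, hρ, hlt⟩
    refine lt_of_le_of_lt (Finset.sum_le_sum fun i _ => hρ i) ?_
    rwa [← EReal.coe_finset_sum, EReal.coe_lt_coe_iff]

theorem exists_separableSum_lt (hf : ∀ i, IsGammaZero (f i)) :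
    ∃ (x : ProdSpace X m) (r : ℝ), separableSum f x < r := by
  choose a ha using fun i => (hf i).exists_ne_top
  refine ⟨WithLp.toLp 2 a, ∑ i, (f i (a i)).toReal + 1, (separableSum_lt_coe_iff hf).2
    ⟨fun i => (f i (a i)).toReal, fun i => ?_, lt_add_one _⟩⟩
  exact (EReal.coe_toReal (ha i) ((hf i).ne_bot _)).ge

/-- The infimal convolution of `F` and the indicator of `C` takes at `x` the infimum of `F` over
`x - C`; for values `⊥` of `F`, `⊥ + ⊤ = ⊥` would break this. -/
theorem infConvolution_convexIndicator_lt_iff {E : Type*} [NormedAddCommGroup E]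
    {F : E → EReal} (hF : ∀ x, F x ≠ ⊥) {C : Set E} {x : E} {a : EReal} :
    infConvolution F (convexIndicator C) x < a ↔ ∃ y, x - y ∈ C ∧ F y < a := by
  rw [infConvolution, iInf_lt_iff]
  refine exists_congr fun y => ?_
  by_cases hy : x - y ∈ C
  · simp [convexIndicator, hy]
  · simp [convexIndicator, hy, EReal.add_top_of_ne_bot (hF y)]

/-- The function `f □ ι_Δ`, whose lower semicontinuous hull is `regularized f`. -/
noncomputable abbrev diagonalInfConvolution (f : Fin m → X → EReal) : ProdSpace X m → EReal :=
  infConvolution (separableSum f) (convexIndicator (diagonal X m : Set (ProdSpace X m)))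

theorem convex_strict_epigraph_diagonalInfConvolution (hf : ∀ i, IsGammaZero (f i)) :
    Convex ℝ {p : ProdSpace X m × ℝ | diagonalInfConvolution f p.1 < (p.2 : EReal)} := by
  rintro ⟨x, r⟩ hx ⟨x', r'⟩ hx' a b ha hb hab
  obtain ⟨y, hy, hy'⟩ := (infConvolution_convexIndicator_lt_iff (separableSum_ne_bot hf)).1 hx
  obtain ⟨ρ, hρ, hρr⟩ := (separableSum_lt_coe_iff hf).1 hy'
  obtain ⟨z, hz, hz'⟩ := (infConvolution_convexIndicator_lt_iff (separableSum_ne_bot hf)).1 hx'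
  obtain ⟨σ, hσ, hσr⟩ := (separableSum_lt_coe_iff hf).1 hz'
  refine (infConvolution_convexIndicator_lt_iff (separableSum_ne_bot hf)).2
    ⟨a • y + b • z, ?_, (separableSum_lt_coe_iff hf).2 ⟨fun i => a * ρ i + b * σ i, fun i => ?_, ?_⟩⟩
  · have : a • x + b • x' - (a • y + b • z) = a • (x - y) + b • (x' - z) := by module
    change a • x + b • x' - (a • y + b • z) ∈ diagonal X m
    rw [this]
    exact add_mem (Submodule.smul_mem _ _ hy) (Submodule.smul_mem _ _ hz)
  · exact (hf i).convex (x := (y i, ρ i)) (hρ i) (y := (z i, σ i)) (hσ i) ha hb hab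
  · rw [Finset.sum_add_distrib, ← Finset.mul_sum, ← Finset.mul_sum]
    change _ < a * r + b * r'
    change ∑ i, ρ i < r at hρr
    change ∑ i, σ i < r' at hσr
    rcases ha.lt_or_eq with ha' | rfl
    · exact add_lt_add_of_lt_of_le (mul_lt_mul_of_pos_left hρr ha')
        (mul_le_mul_of_nonneg_left hσr.le hb)
    · have : b = 1 := by linarith
      subst this
      linarith

theorem regularized_le_separableSum (hf : ∀ i, IsGammaZero (f i)) (x : ProdSpace X m) :
    regularized f x ≤ separableSum f x := by
  refine (lscHull_le _ x).trans (le_of_forall_gt fun a ha => ?_)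
  refine (infConvolution_convexIndicator_lt_iff (separableSum_ne_bot hf)).2 ⟨x, ?_, ha⟩
  rw [sub_self]
  exact zero_mem (diagonal X m)

/-- The function `cl (f □ ι_Δ)` is invariant under translations along the diagonal. -/
theorem regularized_add_le (hf : ∀ i, IsGammaZero (f i)) (x : ProdSpace X m) {d : ProdSpace X m}
    (hd : d ∈ diagonal X m) : regularized f (x + d) ≤ regularized f x := by
  refine le_lscHull (h := fun z => regularized f (z + d)) (fun z a ha => ?_) (fun z => ?_) x
  · exact (continuous_add_const d).tendsto z |>.eventually
      (lowerSemicontinuous_lscHull _ (z + d) a ha)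
  · refine (lscHull_le _ _).trans (le_of_forall_gt fun a ha => ?_)
    obtain ⟨y, hy, hy'⟩ := (infConvolution_convexIndicator_lt_iff (separableSum_ne_bot hf)).1 ha
    refine (infConvolution_convexIndicator_lt_iff (separableSum_ne_bot hf)).2 ⟨y, ?_, hy'⟩
    rw [add_sub_right_comm]
    exact add_mem (S := Submodule ℝ (ProdSpace X m)) hy hd

theorem regularized_add (hf : ∀ i, IsGammaZero (f i)) (x : ProdSpace X m) {d : ProdSpace X m}
    (hd : d ∈ diagonal X m) : regularized f (x + d) = regularized f x := by
  refine le_antisymm (regularized_add_le hf x hd) ?_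
  simpa using regularized_add_le hf (x + d) (neg_mem hd)

theorem mem_subdifferential_regularized_add (hf : ∀ i, IsGammaZero (f i)) {x u d : ProdSpace X m}
    (hd : d ∈ diagonal X m) (hu : u ∈ subdifferential (regularized f) x) :
    u ∈ subdifferential (regularized f) (x + d) := by
  intro z
  have := hu (z - d)
  rw [regularized_add hf x hd, show z - (x + d) = z - d - x by abel]
  refine this.trans_eq ?_
  simpa using (regularized_add hf (z - d) hd).symm

/-- An element of `Δᗮ` at which the conjugate of `f` is finite gives an affine minorant of
`cl (f □ ι_Δ)`. -/
theorem coe_le_regularized (hf : ∀ i, IsGammaZero (f i)) {u : ProdSpace X m}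
    (hu : u ∈ (diagonal X m)ᗮ) {b : ℝ} (hb : conjugate (separableSum f) u ≤ b)
    (x : ProdSpace X m) : ((inner ℝ x u - b : ℝ) : EReal) ≤ regularized f x := by
  refine le_lscHull (h := fun x => ((inner ℝ x u - b : ℝ) : EReal)) ?_ (fun z => ?_) x
  · have : Continuous fun x : ProdSpace X m => inner ℝ x u - b := by fun_prop
    exact (continuous_coe_real_ereal.comp this).lowerSemicontinuous
  · refine le_of_forall_gt fun a ha => ?_
    obtain ⟨y, hy, hy'⟩ := (infConvolution_convexIndicator_lt_iff (separableSum_ne_bot hf)).1 ha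
    refine lt_of_le_of_lt ?_ hy'
    have hzy : inner ℝ z u = inner ℝ y u := by
      have := hu _ hy
      rwa [inner_sub_left, sub_eq_zero] at this
    have h := (le_iSup (fun x => ((inner ℝ x u : ℝ) : EReal) - separableSum f x) y).trans hb
    rw [hzy]
    have hbot := separableSum_ne_bot hf y
    generalize separableSum f y = c at h hbot
    induction c with
    | bot => exact absurd rfl hbot
    | top => exact le_top
    | coe c =>
      norm_cast at h ⊢
      linarith

theorem conjugate_diagonal_of_mem {u : ProdSpace X m} (hu : u ∈ (diagonal X m)ᗮ) :
    conjugate (convexIndicator (diagonal X m : Set (ProdSpace X m))) u = 0 := by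
  refine le_antisymm (iSup_le fun x => ?_) ?_
  · by_cases hx : x ∈ diagonal X m
    · simp [convexIndicator, hx, hu x hx]
    · simp [convexIndicator, hx]
  · refine le_iSup_of_le 0 ?_
    simp [convexIndicator]

theorem conjugate_diagonal_of_notMem {u : ProdSpace X m} (hu : u ∉ (diagonal X m)ᗮ) :
    conjugate (convexIndicator (diagonal X m : Set (ProdSpace X m))) u = ⊤ := by
  rw [Submodule.mem_orthogonal] at hu
  push Not at hu
  obtain ⟨d, hd, hne⟩ := hu
  rw [EReal.eq_top_iff_forall_lt]
  intro c
  -- A multiple of `d` whose inner product with `u` is `c + 1`.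
  refine lt_of_lt_of_le ?_ (le_iSup _ (((c + 1) / inner ℝ d u) • d))
  rw [convexIndicator, if_pos (SetLike.mem_coe.2 (Submodule.smul_mem _ _ hd)),
    real_inner_smul_left, div_mul_cancel₀ _ hne, sub_zero, EReal.coe_lt_coe_iff]
  exact lt_add_one c

theorem conjugate_separableSum_ne_bot (hf : ∀ i, IsGammaZero (f i)) (u : ProdSpace X m) :
    conjugate (separableSum f) u ≠ ⊥ := by
  obtain ⟨x, r, hx⟩ := exists_separableSum_lt hf
  refine ne_bot_of_le_ne_bot ?_ (le_iSup _ x)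
  have hbot := separableSum_ne_bot hf x
  generalize separableSum f x = c at hx hbot
  induction c with
  | bot => exact absurd rfl hbot
  | top => exact absurd hx not_top_lt
  | coe c => exact EReal.coe_ne_bot _

theorem dualFunction_of_mem {u : ProdSpace X m} (hu : u ∈ (diagonal X m)ᗮ) :
    dualFunction f u = conjugate (separableSum f) u := by
  rw [dualFunction, conjugate_diagonal_of_mem hu, add_zero]

theorem dualFunction_of_notMem (hf : ∀ i, IsGammaZero (f i)) {u : ProdSpace X m}
    (hu : u ∉ (diagonal X m)ᗮ) : dualFunction f u = ⊤ := by
  rw [dualFunction, conjugate_diagonal_of_notMem hu,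
    EReal.add_top_of_ne_bot (conjugate_separableSum_ne_bot hf u)]

theorem dualFunction_ne_bot (hf : ∀ i, IsGammaZero (f i)) (u : ProdSpace X m) :
    dualFunction f u ≠ ⊥ := by
  by_cases hu : u ∈ (diagonal X m)ᗮ
  · rw [dualFunction_of_mem hu]
    exact conjugate_separableSum_ne_bot hf u
  · rw [dualFunction_of_notMem hf hu]
    exact top_ne_bot

theorem exists_affine_le_regularized (hf : ∀ i, IsGammaZero (f i))
    (hdom : (effDomain (dualFunction f)).Nonempty) : ∃ (u : ProdSpace X m) (b : ℝ),
      ∀ x, ((inner ℝ x u - b : ℝ) : EReal) ≤ regularized f x := by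
  obtain ⟨u, hu⟩ := hdom
  have hmem : u ∈ (diagonal X m)ᗮ := by
    by_contra h
    exact (ne_of_lt hu) (dualFunction_of_notMem hf h)
  refine ⟨u, (conjugate (separableSum f) u).toReal, coe_le_regularized hf hmem ?_⟩
  rw [effDomain, Set.mem_ofPred_eq, dualFunction_of_mem hmem] at hu
  exact (EReal.coe_toReal hu.ne (conjugate_separableSum_ne_bot hf u)).ge

theorem isGammaZero_regularized (hf : ∀ i, IsGammaZero (f i))
    (hdom : (effDomain (dualFunction f)).Nonempty) : IsGammaZero (regularized f) where
  ne_bot x := by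
    obtain ⟨u, b, h⟩ := exists_affine_le_regularized hf hdom
    exact ne_bot_of_le_ne_bot (EReal.coe_ne_bot _) (h x)
  exists_ne_top := by
    obtain ⟨x, r, hx⟩ := exists_separableSum_lt hf
    exact ⟨x, ((regularized_le_separableSum hf x).trans_lt (hx.trans_le le_top)).ne⟩
  lsc := lowerSemicontinuous_lscHull _
  convex := by
    rw [regularized, epigraph_lscHull]
    exact (convex_strict_epigraph_diagonalInfConvolution hf).closure

theorem mem_orthogonal_of_mem_subdifferential_regularized (hf : ∀ i, IsGammaZero (f i))
    (hdom : (effDomain (dualFunction f)).Nonempty) {x u : ProdSpace X m}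
    (hu : u ∈ subdifferential (regularized f) x) : u ∈ (diagonal X m)ᗮ := by
  have hg := isGammaZero_regularized hf hdom
  obtain ⟨r, hr⟩ := exists_coe_eq_of_mem_subdifferential hg.ne_bot hg.exists_ne_top hu
  have key : ∀ d ∈ diagonal X m, inner ℝ u d ≤ 0 := by
    intro d hd
    have h := hu (x + d)
    rw [regularized_add hf x hd, hr, add_sub_cancel_left] at h
    norm_cast at h
    linarith
  intro d hd
  rw [real_inner_comm]
  refine le_antisymm (key d hd) ?_
  have := key (-d) (neg_mem hd)
  rw [inner_neg_right] at this
  linarith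

/-- Inversion of subgradients between `cl (f □ ι_Δ)` and `f* + ι_Δ*`. Only the Fenchel–Young
inequality is needed, not biconjugation. -/
theorem mem_subdifferential_dualFunction (hf : ∀ i, IsGammaZero (f i))
    (hdom : (effDomain (dualFunction f)).Nonempty) {x u : ProdSpace X m}
    (hu : u ∈ subdifferential (regularized f) x) : x ∈ subdifferential (dualFunction f) u := by
  have hg := isGammaZero_regularized hf hdom
  have huK := mem_orthogonal_of_mem_subdifferential_regularized hf hdom hu
  obtain ⟨r, hr⟩ := exists_coe_eq_of_mem_subdifferential hg.ne_bot hg.exists_ne_top hu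
  have hle : dualFunction f u ≤ ((inner ℝ x u - r : ℝ) : EReal) := by
    rw [dualFunction_of_mem huK]
    refine iSup_le fun z => ?_
    have h := (hu z).trans (regularized_le_separableSum hf z)
    rw [hr] at h
    have hbot := separableSum_ne_bot hf z
    generalize separableSum f z = c at h hbot
    induction c with
    | bot => exact absurd rfl hbot
    | top => exact bot_le
    | coe c =>
      norm_cast at h ⊢
      rw [inner_sub_right, real_inner_comm z, real_inner_comm x] at h
      linarith
  intro w
  by_cases hw : w ∈ (diagonal X m)ᗮ
  · rcases eq_or_ne (dualFunction f w) ⊤ with ht | ht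
    · rw [ht]; exact le_top
    · have hc := EReal.coe_toReal ht (dualFunction_ne_bot hf w)
      have hmin := coe_le_regularized hf hw (b := (dualFunction f w).toReal)
        (by rw [hc, dualFunction_of_mem hw]) x
      rw [hr, EReal.coe_le_coe_iff] at hmin
      rw [← hc]
      refine (add_le_add_left hle _).trans ?_
      rw [← EReal.coe_add, EReal.coe_le_coe_iff, inner_sub_right]
      linarith
  · rw [dualFunction_of_notMem hf hw]
    exact le_top

end Regularization

/-! ### Proximal mappings and averaged steps -/

section Proximal

variable {E : Type*} [NormedAddCommGroup E] [InnerProductSpace ℝ E]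

theorem sub_mem_subdifferential_const_mul_iff {g : E → EReal} (hbot : ∀ x, g x ≠ ⊥) {γ : ℝ}
    (hγ : 0 < γ) {v p : E} :
    v - p ∈ subdifferential (fun z => (γ : EReal) * g z) p ↔
      γ⁻¹ • (v - p) ∈ subdifferential g p := by
  rw [← mem_subdifferential_const_mul hbot hγ, smul_inv_smul₀ hγ.ne']

/-- Firm nonexpansiveness of proximal mappings. -/
theorem norm_sq_le_inner_of_sub_mem_subdifferential {g : E → EReal} (hg : IsGammaZero g) {γ : ℝ}
    (hγ : 0 < γ) {v p v' p' : E}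
    (hp : v - p ∈ subdifferential (fun z => (γ : EReal) * g z) p)
    (hp' : v' - p' ∈ subdifferential (fun z => (γ : EReal) * g z) p') :
    ‖p - p'‖ ^ 2 ≤ inner ℝ (v - v') (p - p') := by
  rw [sub_mem_subdifferential_const_mul_iff hg.ne_bot hγ] at hp hp'
  have h := inner_nonneg_of_mem_subdifferential hg.ne_bot hg.exists_ne_top hp hp'
  have e : γ⁻¹ • (v - p) - γ⁻¹ • (v' - p') = γ⁻¹ • ((v - v') - (p - p')) := by module
  rw [e, real_inner_smul_left, inner_sub_left, real_inner_self_eq_norm_sq] at h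
  linarith [nonneg_of_mul_nonneg_right h (inv_pos.2 hγ)]

theorem existsUnique_sub_mem_subdifferential_const_mul [CompleteSpace E] {g : E → EReal}
    (hg : IsGammaZero g) {u : E} {b : ℝ} (hub : ∀ z, ((inner ℝ z u - b : ℝ) : EReal) ≤ g z)
    {γ : ℝ} (hγ : 0 < γ) (v : E) :
    ∃! p, v - p ∈ subdifferential (fun z => (γ : EReal) * g z) p := by
  obtain ⟨p, hp⟩ := hg.exists_smul_sub_mem_subdifferential hub (inv_pos.2 hγ) v
  have hp' := (sub_mem_subdifferential_const_mul_iff hg.ne_bot hγ).2 hp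
  refine ⟨p, hp', fun p' h' => ?_⟩
  have h := norm_sq_le_inner_of_sub_mem_subdifferential hg hγ h' hp'
  rw [sub_self, inner_zero_left] at h
  exact sub_eq_zero.1 (norm_eq_zero.1
    ((pow_eq_zero_iff two_ne_zero).1 (le_antisymm h (sq_nonneg _))))

theorem norm_le_of_norm_sq_le_inner {b p : E} (h : ‖p‖ ^ 2 ≤ inner ℝ b p) : ‖p‖ ≤ ‖b‖ := by
  have hcs := h.trans (real_inner_le_norm _ _)
  rcases (norm_nonneg p).eq_or_lt with h0 | hpos
  · rw [← h0]; exact norm_nonneg _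
  · rw [pow_two] at hcs
    exact le_of_mul_le_mul_right hcs hpos

theorem norm_sq_convex_combination (γ : ℝ) {w w' : E} (hw : ‖w'‖ = ‖w‖) :
    ‖(1 - γ) • w + γ • w'‖ ^ 2 = ‖w‖ ^ 2 - γ * (1 - γ) * ‖w - w'‖ ^ 2 := by
  rw [norm_add_sq_real, norm_sub_sq_real, norm_smul, norm_smul, mul_pow, mul_pow,
    Real.norm_eq_abs, Real.norm_eq_abs, sq_abs, sq_abs, real_inner_smul_left,
    real_inner_smul_right, hw]
  ring

/-- A firmly nonexpansive map after `(1 - γ) Id + γ R` is averaged with constant `1 / (2 - γ)`;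
the estimate is for the displacement `w` from a fixed point, with image `p`. -/
theorem norm_sq_relaxed_le {γ l : ℝ} (hγ : 0 ≤ γ) (hl : 0 ≤ l) {w w' p : E} (hw : ‖w'‖ = ‖w‖)
    (hp : ‖p‖ ^ 2 ≤ inner ℝ ((1 - γ) • w + γ • w') p) :
    ‖w + l • (p - w)‖ ^ 2 ≤ ‖w‖ ^ 2 - l * (2 - γ - l) * ‖p - w‖ ^ 2 := by
  rw [inner_add_left, real_inner_smul_left, real_inner_smul_left] at hp
  have h1 := sq_nonneg ‖w' - p‖
  rw [norm_sub_sq_real, hw] at h1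
  have h2 : 2 * inner ℝ w (p - w) ≤ -(2 - γ) * ‖p - w‖ ^ 2 := by
    rw [norm_sub_sq_real, inner_sub_right, real_inner_self_eq_norm_sq, real_inner_comm w p]
    nlinarith [mul_nonneg hγ h1]
  rw [norm_add_sq_real, real_inner_smul_right, norm_smul, mul_pow, Real.norm_eq_abs, sq_abs]
  nlinarith [mul_le_mul_of_nonneg_left h2 hl]

end Proximal

theorem tendsto_zero_of_le_sub_mul {a s : ℕ → ℝ} {κ : ℝ} (hκ : 0 < κ) (ha : ∀ n, 0 ≤ a n)
    (hs : ∀ n, 0 ≤ s n) (hsum : Tendsto (fun N => ∑ n ∈ Finset.range N, s n) atTop atTop)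
    (hrec : ∀ n, a (n + 1) ≤ a n - κ * s n * a n) : Tendsto a atTop (𝓝 0) := by
  have hanti : Antitone a := antitone_nat_of_succ_le fun n => by
    have := mul_nonneg (mul_nonneg hκ.le (hs n)) (ha n)
    linarith [hrec n]
  have hbdd : BddBelow (Set.range a) := ⟨0, by rintro _ ⟨n, rfl⟩; exact ha n⟩
  have hlim := tendsto_atTop_ciInf hanti hbdd
  set L := ⨅ n, a n
  have hL : ∀ n, L ≤ a n := fun n => ciInf_le hbdd n
  have hL0 : 0 ≤ L := le_ciInf ha
  rcases hL0.eq_or_lt with h0 | hpos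
  · rwa [← h0] at hlim
  -- Otherwise telescoping bounds the partial sums of `s` by `a 0 / (κ * L)`.
  · exfalso
    have htel : ∀ N, κ * L * ∑ n ∈ Finset.range N, s n ≤ a 0 - a N := by
      intro N
      induction N with
      | zero => simp
      | succ N ih =>
        rw [Finset.sum_range_succ, mul_add]
        have := mul_le_mul_of_nonneg_left (hL N) (mul_nonneg hκ.le (hs N))
        linarith [hrec N]
    obtain ⟨N, hN⟩ := (hsum.eventually_gt_atTop (a 0 / (κ * L))).exists
    rw [div_lt_iff₀ (by positivity)] at hN
    linarith [htel N, ha N]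

/-! ### Generalized cycles and gap vectors -/

section Cycles

variable {X : Type*} [NormedAddCommGroup X] [InnerProductSpace ℝ X] {m : ℕ}
  {f : Fin m → X → EReal}

theorem exists_norm_convex_combination_shift_le [NeZero m] {γ : ℝ} (hγ : γ ∈ Set.Ioo (0 : ℝ) 1) :
    ∃ q : ℝ, 0 ≤ q ∧ q < 1 ∧ ∀ w : ProdSpace X m, w ∈ (diagonal X m)ᗮ →
      ‖(1 - γ) • w + γ • shift X m w‖ ≤ q * ‖w‖ := by
  obtain ⟨C, hC, hbd⟩ := exists_norm_le_mul_norm_sub_shift (X := X) (m := m)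
  have hpos : 0 < γ * (1 - γ) := mul_pos hγ.1 (sub_pos.2 hγ.2)
  have hC0 : 0 < C := by linarith
  refine ⟨√(1 - γ * (1 - γ) / C ^ 2), Real.sqrt_nonneg _, ?_, fun w hw => ?_⟩
  · rw [Real.sqrt_lt' one_pos, one_pow]
    exact sub_lt_self _ (by positivity)
  · have h1 : ‖w‖ ^ 2 / C ^ 2 ≤ ‖w - shift X m w‖ ^ 2 := by
      rw [div_le_iff₀ (by positivity), ← mul_pow, mul_comm]
      exact pow_le_pow_left₀ (norm_nonneg _) (hbd w hw) 2
    have h2 : 0 ≤ 1 - γ * (1 - γ) / C ^ 2 := by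
      rw [sub_nonneg, div_le_one (by positivity)]
      nlinarith [sq_nonneg (γ - 1 / 2)]
    refine (pow_le_pow_iff_left₀ (norm_nonneg _) (by positivity) two_ne_zero).1 ?_
    rw [norm_sq_convex_combination γ (LinearIsometryEquiv.norm_map _ w), mul_pow, Real.sq_sqrt h2]
    calc ‖w‖ ^ 2 - γ * (1 - γ) * ‖w - shift X m w‖ ^ 2
        ≤ ‖w‖ ^ 2 - γ * (1 - γ) * (‖w‖ ^ 2 / C ^ 2) :=
          sub_le_sub_left (mul_le_mul_of_nonneg_left h1 hpos.le) _
      _ = (1 - γ * (1 - γ) / C ^ 2) * ‖w‖ ^ 2 := by ring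

theorem isGeneralizedCycle_iff {x : ProdSpace X m} :
    IsGeneralizedCycle f x ↔ shift X m x - x ∈ subdifferential (regularized f) x := by
  rw [IsGeneralizedCycle, Set.add_singleton, Set.mem_image]
  constructor
  · rintro ⟨u, hu, h⟩
    rwa [show shift X m x - x = u by rw [← sub_eq_zero, ← neg_eq_zero, ← h]; abel]
  · exact fun h => ⟨_, h, by abel⟩

theorem isGeneralizedGapVector_iff {y : ProdSpace X m} :
    IsGeneralizedGapVector f y ↔
      -((1 / 2 : ℝ) • y + skewOp y) ∈ subdifferential (dualFunction f) y := by
  rw [IsGeneralizedGapVector, Set.add_singleton, Set.mem_image]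
  constructor
  · rintro ⟨u, hu, h⟩
    rwa [← eq_neg_of_add_eq_zero_left h]
  · exact fun h => ⟨_, h, neg_add_cancel _⟩

theorem SolvesEnlargedPrimal.unique [NeZero m] (hf : ∀ i, IsGammaZero (f i))
    (hdom : (effDomain (dualFunction f)).Nonempty) {x x' : ProdSpace X m}
    (hx : SolvesEnlargedPrimal f x) (hx' : SolvesEnlargedPrimal f x') : x = x' := by
  have hg := isGammaZero_regularized hf hdom
  have h := inner_nonneg_of_mem_subdifferential hg.ne_bot hg.exists_ne_top
    (isGeneralizedCycle_iff.1 hx.1) (isGeneralizedCycle_iff.1 hx'.1)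
  have e : shift X m x - x - (shift X m x' - x') = shift X m (x - x') - (x - x') := by
    rw [map_sub]; abel
  rw [e, inner_shift_sub_self] at h
  have h0 : ‖shift X m (x - x') - (x - x')‖ = 0 := by
    rw [← pow_eq_zero_iff two_ne_zero]
    exact le_antisymm (by linarith) (sq_nonneg _)
  exact sub_eq_zero.1 (eq_zero_of_mem_diagonal_orthogonal_of_shift_eq (sub_mem hx.2 hx'.2)
    (sub_eq_zero.1 (norm_eq_zero.1 h0)))

/-- The subdifferential of `f* + ι_Δ*` is monotone and `Id / 2 + T` is strongly monotone. -/
theorem IsGeneralizedGapVector.unique [NeZero m] (hf : ∀ i, IsGammaZero (f i))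
    (hdom : (effDomain (dualFunction f)).Nonempty) {y y' : ProdSpace X m}
    (hy : IsGeneralizedGapVector f y) (hy' : IsGeneralizedGapVector f y') : y = y' := by
  obtain ⟨u, hu⟩ := hdom
  have h := inner_nonneg_of_mem_subdifferential (dualFunction_ne_bot hf) ⟨u, ne_of_lt hu⟩
    (isGeneralizedGapVector_iff.1 hy) (isGeneralizedGapVector_iff.1 hy')
  have e : -((1 / 2 : ℝ) • y + skewOp y) - -((1 / 2 : ℝ) • y' + skewOp y')
      = -((1 / 2 : ℝ) • (y - y') + skewOp (y - y')) := by
    rw [skewOp_sub]; module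
  rw [e, inner_neg_left, inner_add_left, real_inner_smul_left, real_inner_self_eq_norm_sq,
    real_inner_comm, inner_skewOp_self] at h
  have h0 : ‖y - y'‖ = 0 := by
    rw [← pow_eq_zero_iff two_ne_zero]
    exact le_antisymm (by linarith) (sq_nonneg _)
  exact sub_eq_zero.1 (norm_eq_zero.1 h0)

theorem SolvesEnlargedPrimal.isGeneralizedGapVector [NeZero m] (hf : ∀ i, IsGammaZero (f i))
    (hdom : (effDomain (dualFunction f)).Nonempty) {x : ProdSpace X m}
    (hx : SolvesEnlargedPrimal f x) : IsGeneralizedGapVector f (shift X m x - x) := by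
  rw [isGeneralizedGapVector_iff]
  have e : -((1 / 2 : ℝ) • (shift X m x - x) + skewOp (shift X m x - x)) = x := by
    conv_rhs => rw [← half_smul_add_skewOp_sub_shift hx.2]
    rw [skewOp_sub, skewOp_sub]
    module
  rw [e]
  exact mem_subdifferential_dualFunction hf hdom (isGeneralizedCycle_iff.1 hx.1)

variable [CompleteSpace X]

theorem existsUnique_prox_regularized (hf : ∀ i, IsGammaZero (f i))
    (hdom : (effDomain (dualFunction f)).Nonempty) {γ : ℝ} (hγ : 0 < γ) (v : ProdSpace X m) :
    ∃! p, v - p ∈ subdifferential (fun z => (γ : EReal) * regularized f z) p := by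
  obtain ⟨u, b, h⟩ := exists_affine_le_regularized hf hdom
  exact existsUnique_sub_mem_subdifferential_const_mul (isGammaZero_regularized hf hdom) h hγ v

theorem sub_prox_mem_subdifferential (hf : ∀ i, IsGammaZero (f i))
    (hdom : (effDomain (dualFunction f)).Nonempty) {γ : ℝ} (hγ : 0 < γ) (v : ProdSpace X m) :
    v - prox (fun z => (γ : EReal) * regularized f z) v ∈
      subdifferential (fun z => (γ : EReal) * regularized f z)
        (prox (fun z => (γ : EReal) * regularized f z) v) :=
  Classical.epsilon_spec (existsUnique_prox_regularized hf hdom hγ v).exists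

theorem sub_prox_mem_orthogonal (hf : ∀ i, IsGammaZero (f i))
    (hdom : (effDomain (dualFunction f)).Nonempty) {γ : ℝ} (hγ : 0 < γ) (v : ProdSpace X m) :
    v - prox (fun z => (γ : EReal) * regularized f z) v ∈ (diagonal X m)ᗮ := by
  have h := (sub_mem_subdifferential_const_mul_iff (isGammaZero_regularized hf hdom).ne_bot hγ).1
    (sub_prox_mem_subdifferential hf hdom hγ v)
  have := Submodule.smul_mem _ γ (mem_orthogonal_of_mem_subdifferential_regularized hf hdom h)
  rwa [smul_inv_smul₀ hγ.ne'] at this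

/-- Existence for the enlarged primal problem: `u ↦ Prox_{γ g} ((1 - γ) u + γ R u)` is a strict
contraction of `Δᗮ`, and its fixed point is a solution. -/
theorem exists_solvesEnlargedPrimal [NeZero m] (hf : ∀ i, IsGammaZero (f i))
    (hdom : (effDomain (dualFunction f)).Nonempty) : ∃ z, SolvesEnlargedPrimal f z := by
  -- Any `γ` strictly between `0` and `1` would do.
  obtain ⟨γ, hγ⟩ : ∃ γ : ℝ, γ ∈ Set.Ioo (0 : ℝ) 1 := ⟨1 / 2, by norm_num⟩
  have hg := isGammaZero_regularized hf hdom
  obtain ⟨q, hq0, hq1, hq⟩ := exists_norm_convex_combination_shift_le (X := X) (m := m) hγ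
  let b : ProdSpace X m → ProdSpace X m := fun u => (1 - γ) • u + γ • shift X m u
  let N : ProdSpace X m → ProdSpace X m :=
    fun u => prox (fun z => (γ : EReal) * regularized f z) (b u)
  have hN : Set.MapsTo N ((diagonal X m)ᗮ : Set (ProdSpace X m)) (diagonal X m)ᗮ := by
    intro u hu
    have hb : b u ∈ (diagonal X m)ᗮ := add_mem (Submodule.smul_mem _ _ hu)
      (Submodule.smul_mem _ _ (shift_mem_diagonal_orthogonal hu))
    have := sub_mem hb (sub_prox_mem_orthogonal hf hdom hγ.1 (b u))
    rwa [sub_sub_cancel] at this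
  have hcontr : ContractingWith ⟨q, hq0⟩ (hN.restrict N _ _) := by
    refine ⟨hq1, LipschitzWith.of_dist_le_mul fun u u' => ?_⟩
    rw [Subtype.dist_eq, Subtype.dist_eq, dist_eq_norm, dist_eq_norm]
    change ‖N u - N u'‖ ≤ q * ‖(u : ProdSpace X m) - u'‖
    have hfirm := norm_sq_le_inner_of_sub_mem_subdifferential hg hγ.1
      (sub_prox_mem_subdifferential hf hdom hγ.1 (b u))
      (sub_prox_mem_subdifferential hf hdom hγ.1 (b u'))
    have hbb : ‖b u - b u'‖ ≤ q * ‖(u : ProdSpace X m) - u'‖ := by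
      have e : b u - b u' = (1 - γ) • ((u : ProdSpace X m) - u')
          + γ • shift X m ((u : ProdSpace X m) - u') := by
        simp only [b, map_sub]; module
      rw [e]
      exact hq _ (sub_mem u.2 u'.2)
    exact (norm_le_of_norm_sq_le_inner hfirm).trans hbb
  obtain ⟨z, hz, hfix, -⟩ := hcontr.exists_fixedPoint'
    (Submodule.isClosed_orthogonal _).isComplete hN (zero_mem (diagonal X m)ᗮ)
    (edist_ne_top _ _)
  refine ⟨z, isGeneralizedCycle_iff.2 ?_, hz⟩
  have h := sub_prox_mem_subdifferential hf hdom hγ.1 (b z)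
  change b z - N z ∈ subdifferential _ (N z) at h
  rw [hfix.eq, show b z - z = γ • (shift X m z - z) by simp only [b]; module] at h
  exact (mem_subdifferential_const_mul hg.ne_bot hγ.1).1 h

end Cycles

/-! ### Convergence of the iteration -/

theorem theorem6p2 {X : Type*} [NormedAddCommGroup X] [InnerProductSpace ℝ X] [CompleteSpace X]
    (m : ℕ) (hm : 1 ≤ m)
    (f : Fin m → X → EReal) (hf : ∀ i, IsGammaZero (f i))
    (hdom : (effDomain (dualFunction f)).Nonempty)
    (γ : ℝ) (hγ : γ ∈ Set.Ioo (0 : ℝ) 1) (δ : ℝ) (hδ : δ = 2 - γ)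
    (lam : ℕ → ℝ) (hlam : ∀ n, lam n ∈ Set.Ioo (0 : ℝ) δ)
    (hsum : Tendsto (fun N => ∑ n ∈ Finset.range N, lam n * (δ - lam n)) atTop atTop)
    (x y : ℕ → ProdSpace X m)
    (hy : ∀ n, y n = (1 - γ) • x n + γ • shift X m (x n))
    (hx : ∀ n, x (n + 1) =
      x n + lam n • (prox (fun z => (γ : EReal) * regularized f z) (y n) - x n)) :
    -- the proximal mapping of `γ g` is well defined: `(Id + ∂(γ g))⁻¹` is single-valued
    -- and everywhere defined
    (∀ v : ProdSpace X m, ∃! p : ProdSpace X m,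
      v - p ∈ subdifferential (fun z => (γ : EReal) * regularized f z) p) ∧
    ∃ xt : ProdSpace X m,
      -- weak convergence to a generalized cycle
      (IsGeneralizedCycle f xt ∧
        Tendsto (fun n => toWeakSpace ℝ (ProdSpace X m) (x n)) atTop
          (𝓝 (toWeakSpace ℝ (ProdSpace X m) xt))) ∧
      -- strong convergence to the unique generalized gap vector
      (Tendsto (fun n => shift X m (x n) - x n) atTop (𝓝 (shift X m xt - xt)) ∧
        IsGeneralizedGapVector f (shift X m xt - xt) ∧
        ∀ v, IsGeneralizedGapVector f v → v = shift X m xt - xt) ∧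
      -- strong convergence of the projections to the unique solution of the enlarged primal
      (Tendsto (fun n => projPerp X m (x n)) atTop
          (𝓝 (projPerp X m xt)) ∧
        SolvesEnlargedPrimal f (projPerp X m xt) ∧
        ∀ v, SolvesEnlargedPrimal f v → v = projPerp X m xt) := by
  have : NeZero m := ⟨by omega⟩
  subst hδ
  refine ⟨existsUnique_prox_regularized hf hdom hγ.1, ?_⟩
  have hg := isGammaZero_regularized hf hdom
  obtain ⟨z, hz⟩ := exists_solvesEnlargedPrimal hf hdom
  obtain ⟨q, hq0, hq1, hq⟩ := exists_norm_convex_combination_shift_le (X := X) (m := m) hγ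
  have : CompleteSpace (diagonal X m) := isClosed_diagonal_submodule.completeSpace_coe
  -- The component along the diagonal is constant along the iteration, so the limit is `z + d`.
  set d := (diagonal X m).starProjection (x 0)
  have hd : d ∈ diagonal X m := Submodule.starProjection_apply_mem _ _
  have hRd : shift X m d = d := mem_diagonal_iff_shift_eq.1 hd
  have hRxt : shift X m (z + d) - (z + d) = shift X m z - z := by
    rw [map_add, hRd]; abel
  have hproj : projPerp X m (z + d) = z := by
    refine Submodule.eq_starProjection_of_mem_orthogonal hz.2 ?_
    rw [add_sub_cancel_left]
    exact Submodule.le_orthogonal_orthogonal _ hd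
  have hxt : shift X m (z + d) - (z + d) ∈ subdifferential (regularized f) (z + d) := by
    rw [hRxt]
    exact mem_subdifferential_regularized_add hf hd (isGeneralizedCycle_iff.1 hz.1)
  have hxtN : ((1 - γ) • (z + d) + γ • shift X m (z + d)) - (z + d) ∈
      subdifferential (fun z => (γ : EReal) * regularized f z) (z + d) := by
    rw [show ((1 - γ) • (z + d) + γ • shift X m (z + d)) - (z + d)
      = γ • (shift X m (z + d) - (z + d)) by module]
    exact (mem_subdifferential_const_mul hg.ne_bot hγ.1).2 hxt
  set P : ℕ → ProdSpace X m := fun n => prox (fun z => (γ : EReal) * regularized f z) (y n)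
  have hyw : ∀ n, y n - ((1 - γ) • (z + d) + γ • shift X m (z + d))
      = (1 - γ) • (x n - (z + d)) + γ • shift X m (x n - (z + d)) := by
    intro n
    rw [hy, map_sub]
    module
  have hPmem : ∀ n, x n - (z + d) ∈ (diagonal X m)ᗮ → P n - (z + d) ∈ (diagonal X m)ᗮ := by
    intro n hn
    have h1 := sub_prox_mem_orthogonal hf hdom hγ.1 (y n)
    change y n - P n ∈ (diagonal X m)ᗮ at h1
    have h2 : (1 - γ) • (x n - (z + d)) + γ • shift X m (x n - (z + d)) ∈ (diagonal X m)ᗮ :=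
      add_mem (Submodule.smul_mem _ _ hn)
        (Submodule.smul_mem _ _ (shift_mem_diagonal_orthogonal hn))
    rw [← hyw] at h2
    have h3 : γ • (shift X m z - z) ∈ (diagonal X m)ᗮ :=
      Submodule.smul_mem _ _ (sub_mem (shift_mem_diagonal_orthogonal hz.2) hz.2)
    have := add_mem (sub_mem h2 h1) h3
    rw [← hRxt] at this
    convert this using 1
    module
  have hstep : ∀ n, x (n + 1) - (z + d)
      = (x n - (z + d)) + lam n • ((P n - (z + d)) - (x n - (z + d))) := by
    intro n
    rw [hx]
    module
  have hmem : ∀ n, x n - (z + d) ∈ (diagonal X m)ᗮ := by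
    intro n
    induction n with
    | zero =>
      rw [show x 0 - (z + d) = (x 0 - d) - z by abel]
      exact sub_mem (Submodule.sub_starProjection_mem_orthogonal _) hz.2
    | succ n ih =>
      rw [hstep]
      exact add_mem ih (Submodule.smul_mem _ _ (sub_mem (hPmem n ih) ih))
  have hfirm : ∀ n, ‖P n - (z + d)‖ ^ 2 ≤ inner ℝ ((1 - γ) • (x n - (z + d))
      + γ • shift X m (x n - (z + d))) (P n - (z + d)) := by
    intro n
    rw [← hyw]
    exact norm_sq_le_inner_of_sub_mem_subdifferential hg hγ.1
      (sub_prox_mem_subdifferential hf hdom hγ.1 (y n)) hxtN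
  have hrec : ∀ n, ‖x (n + 1) - (z + d)‖ ^ 2 ≤ ‖x n - (z + d)‖ ^ 2
      - (1 - q) ^ 2 * (lam n * (2 - γ - lam n)) * ‖x n - (z + d)‖ ^ 2 := by
    intro n
    have h1 := norm_sq_relaxed_le hγ.1.le (hlam n).1.le (LinearIsometryEquiv.norm_map _ _) (hfirm n)
    rw [← hstep] at h1
    have hcontr : ‖P n - (z + d)‖ ≤ q * ‖x n - (z + d)‖ := by
      exact (norm_le_of_norm_sq_le_inner (hfirm n)).trans (hq _ (hmem n))
    have h2 : (1 - q) * ‖x n - (z + d)‖ ≤ ‖P n - (z + d) - (x n - (z + d))‖ := by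
      have := norm_sub_norm_le (x n - (z + d)) (P n - (z + d))
      rw [norm_sub_rev (x n - (z + d))] at this
      linarith
    have h3 := pow_le_pow_left₀ (mul_nonneg (sub_nonneg.2 hq1.le) (norm_nonneg _)) h2 2
    have h4 : 0 ≤ lam n * (2 - γ - lam n) :=
      mul_nonneg (hlam n).1.le (sub_nonneg.2 (hlam n).2.le)
    have h5 := mul_le_mul_of_nonneg_left h3 h4
    rw [mul_pow] at h5
    linarith
  have hlim : Tendsto x atTop (𝓝 (z + d)) := by
    have h := tendsto_zero_of_le_sub_mul (pow_pos (sub_pos.2 hq1) 2)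
      (fun n => sq_nonneg ‖x n - (z + d)‖)
      (fun n => mul_nonneg (hlam n).1.le (sub_nonneg.2 (hlam n).2.le)) hsum hrec
    rw [tendsto_iff_norm_sub_tendsto_zero]
    simpa using h.sqrt
  refine ⟨z + d, ⟨isGeneralizedCycle_iff.2 hxt, ?_⟩, ⟨?_, ?_, ?_⟩, ?_, ?_, ?_⟩
  · exact ((toWeakSpaceCLM ℝ (ProdSpace X m)).continuous.tendsto _).comp hlim
  · exact (((shift X m).continuous.tendsto _).comp hlim).sub hlim
  · rw [hRxt]
    exact hz.isGeneralizedGapVector hf hdom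
  · intro v hv
    rw [hRxt]
    exact hv.unique hf hdom (hz.isGeneralizedGapVector hf hdom)
  · exact ((projPerp X m).continuous.tendsto _).comp hlim
  · rwa [hproj]
  · intro v hv
    rw [hproj]
    exact hv.unique hf hdom hz
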